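/- **Setting.** A $p$-bit fixed-point format consists of the numbers $k/2^{s}$ with $k\in\mathbb Z$, $-2^{p-1}\le k<2^{p-1}$, for some fixed $0\le s\le p$ (for $p=0$, only the number $0$); rounding to such a format is to the nearest representable number, saturating at the ends of the range. A *multi-layer perceptron* is an arbitrary function $\mathbb R^{a}\to\mathbb R^{b}$, applied separately to every row of a matrix, that reads its argument only through its coordinatewise rounding to a given input format and takes values representable in a given output format. A *single-layer, single-head transformer* with input dimension $a$, embedding dimension $m$, output dimension $1$, precision $p$ and input precision $p_0$, on sequences of length $N$, is a function $$f(X)=\psi\Big(\mathrm{softmax}\big(\phi(X)\,Q\,W^{\mathsf T}\phi(X)^{\mathsf T}\big)\,\phi(X)\,V\Big),\qquad X\in\mathbb R^{N\times a},$$ with row-wise softmax, where $Q,W,V\in\mathbb R^{m\times m}$ have entries in one $p$-bit format, $\phi:\mathbb R^{a}\to\mathbb R^{m}$ is a perceptron with a $p_0$-bit input format and that $p$-bit format as its output format, and $\psi:\mathbb R^{m}\to\mathbb R$ is a perceptron with that $p$-bit format for input and output. For $X=(x_1,\dots,x_N)$ with $x_i\in[M]^d$, where $[M]=\{1,\dots,M\}$,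 let $$\mathrm{Match3Local}(X)_i=\begin{cases}1&\text{if there are } j_1,j_2\in[N] \text{ with } |i-j_1|,|i-j_2|\le K \text{ and } x_i+x_{j_1}+x_{j_2}\equiv 0 \pmod M,\\ 0&\text{otherwise,}\end{cases}$$ the congruence being understood in every coordinate ($d=1$ is the scalar case). **Theorem.** For all integers $d,c\ge 0$ there is a constant $C$, depending only on $d$ and $c$, such that for all integers $N\ge 2$, $1\le M\le N^{c}$ and $1\le K\le N$ there exist a single-layer, single-head transformer $f$ of input dimension $d+1$ with embedding dimension $m\le C\,K\log_2 N$, precision $p\le C\,(1+\log_2(K\log_2 N))$ and input precision $p_0\le C\log_2 N$, such that for every $X\in[M]^{N\times d}$ and every $i\in[N]$, $$f\big((1;x_1),\dots,(N;x_N)\big)_i=\mathrm{Match3Local}(X)_i ,$$ where the position $i$ is supplied as an additional input coordinate. -/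

import Mathlib

noncomputable section

namespace LocalMatch

/-- A signed (two's complement) fixed-point format: `bits` binary digits in total, `frac` of them
after the binary point. -/
structure FixedPointFormat where
  bits : ℕ
  frac : ℕ
  frac_le : frac ≤ bits

namespace FixedPointFormat

/-- Least integer mantissa: `-2 ^ (bits - 1)` (and `0` if there are no bits). -/
def lo (F : FixedPointFormat) : ℤ := -(2 ^ F.bits / 2)

/-- Greatest integer mantissa: `2 ^ (bits - 1) - 1` (and `0` if there are no bits). -/
def hi (F : FixedPointFormat) : ℤ := (2 ^ F.bits - 1) / 2

/-- The real numbers representable in the format. -/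
def values (F : FixedPointFormat) : Set ℝ :=
  {x | ∃ k : ℤ, F.lo ≤ k ∧ k ≤ F.hi ∧ x = (k : ℝ) / 2 ^ F.frac}

/-- Rounding to the nearest representable number, saturating at the ends of the range. -/
def roundTo (F : FixedPointFormat) (x : ℝ) : ℝ :=
  ((max F.lo (min F.hi (round (x * 2 ^ F.frac))) : ℤ) : ℝ) / 2 ^ F.frac

end FixedPointFormat

/-- Row-wise softmax. -/
def rowSoftmax {N N' : ℕ} (A : Matrix (Fin N) (Fin N') ℝ) : Matrix (Fin N) (Fin N') ℝ :=
  fun i j => Real.exp (A i j) / ∑ j', Real.exp (A i j')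

/-- The self-attention map `X ↦ softmax (X Q Kᵀ Xᵀ) X V`. -/
def selfAttention {N d m d' : ℕ} (Q K : Matrix (Fin d) (Fin m) ℝ) (V : Matrix (Fin d) (Fin d') ℝ)
    (X : Matrix (Fin N) (Fin d) ℝ) : Matrix (Fin N) (Fin d') ℝ :=
  rowSoftmax (X * Q * K.transpose * X.transpose) * X * V

/-- Functions taking a sequence of `N` vectors in `ℝ ^ d` to a sequence of `N` vectors in
`ℝ ^ d'`. -/
abbrev SeqMap (N d d' : ℕ) : Type := Matrix (Fin N) (Fin d) ℝ → Matrix (Fin N) (Fin d') ℝ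

/-- Self-attention units of input dimension `d`, embedding dimension `m`, output dimension `d'`,
with all matrix entries representable in the format `F`. -/
def attentionUnits (N d m d' : ℕ) (F : FixedPointFormat) : Set (SeqMap N d d') :=
  {f | ∃ (Q K : Matrix (Fin d) (Fin m) ℝ) (V : Matrix (Fin d) (Fin d') ℝ),
    (∀ a b, Q a b ∈ F.values) ∧ (∀ a b, K a b ∈ F.values) ∧ (∀ a b, V a b ∈ F.values) ∧
    f = selfAttention Q K V}

/-- `H`-headed attention layers: sums of `H` self-attention units. -/
def multiHeadLayers (N d m d' H : ℕ) (F : FixedPointFormat) : Set (SeqMap N d d') :=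
  {L | ∃ f : Fin H → SeqMap N d d', (∀ h, f h ∈ attentionUnits N d m d' F) ∧
    L = fun X => ∑ h, f h X}

/-- Element-wise multi-layer perceptrons, modelled as arbitrary maps applied to every row that read
their argument only through its rounding to the format `Fin₀`, and whose outputs are representable
in the format `Fout`. -/
def mlps (N d d' : ℕ) (Fin₀ Fout : FixedPointFormat) : Set (SeqMap N d d') :=
  {Φ | ∃ φ : (Fin d → ℝ) → (Fin d' → ℝ),
    (∀ x, φ x = φ (fun k => Fin₀.roundTo (x k))) ∧ (∀ x k, φ x k ∈ Fout.values) ∧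
    Φ = fun X i => φ (X i)}

/-- An `H`-headed attention layer of embedding dimension `m`, preceded by an input perceptron. -/
def attentionWithMLP (N d m H : ℕ) (Fin₀ F : FixedPointFormat) : Set (SeqMap N d m) :=
  {g | ∃ Φ ∈ mlps N d m Fin₀ F, ∃ L ∈ multiHeadLayers N m m m H F, g = L ∘ Φ}

/-- Compositions of `D ≥ 1` attention layers with input perceptrons. The first one reads the input
sequence in the format `F₀`; everything else uses the format `F`. -/
def layerStacks (N d m H : ℕ) (F₀ F : FixedPointFormat) : ℕ → Set (SeqMap N d m)
  | 0 => ∅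
  | 1 => attentionWithMLP N d m H F₀ F
  | D + 2 => {g | ∃ g₀ ∈ layerStacks N d m H F₀ F (D + 1),
      ∃ g₁ ∈ attentionWithMLP N m m H F F, g = g₁ ∘ g₀}

/-- Transformers on sequences of length `N` with input dimension `d`, embedding dimension `m`,
output dimension `d'`, depth `D`, `H` heads per layer, and precision `p`: the query, key and value
matrices, all outputs of perceptrons and all inputs of perceptrons after the first one are `p`-bit
fixed-point numbers. The input sequence itself is read with `p₀` bits. -/
def transformers (N d m d' D H p₀ p : ℕ) : Set (SeqMap N d d') :=
  {f | ∃ F₀ F : FixedPointFormat, F₀.bits = p₀ ∧ F.bits = p ∧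
    ∃ g ∈ layerStacks N d m H F₀ F D, ∃ Ψ ∈ mlps N m d' F F, f = Ψ ∘ g}

/-- The input sequence with the (one-based) position of each element as an extra first
coordinate. -/
def withPosition {N d : ℕ} (X : Fin N → Fin d → ℕ) : Matrix (Fin N) (Fin (d + 1)) ℝ :=
  fun i => Fin.cons ((i : ℝ) + 1) (fun k => (X i k : ℝ))

open Classical in
/-- `Match3Local`: the `i`-th entry is `1` if there are `j₁`, `j₂` within distance `K` of `i` with
`x_i + x_{j₁} + x_{j₂} = 0` modulo `M` (in every coordinate), and `0` otherwise. -/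
def match3Local {N d : ℕ} (M K : ℕ) (X : Fin N → Fin d → ℕ) (i : Fin N) : ℝ :=
  if ∃ j₁ j₂ : Fin N, (∀ k, X i k + X j₁ k + X j₂ k ≡ 0 [MOD M]) ∧
      |(i : ℤ) - (j₁ : ℤ)| ≤ (K : ℤ) ∧ |(i : ℤ) - (j₂ : ℤ)| ≤ (K : ℤ)
  then 1 else 0

end LocalMatch

end

/-!
The transformer attends from position `i` to its window of radius `K`, with output coordinates split
into `2 * K + 1` blocks. Call the residue of a position modulo `2 * K + 1` its colour; the positions
of one window have distinct colours. The value of position `j` is written into the block of its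
colour: the bits of `x_j` together with a marker `1`. An average over the window therefore keeps all
the letters of the window apart, and the output perceptron, which may be any function, can read them
off. All numbers used are integers, in a format without fractional part; the value matrix multiplies
by a scale `B` larger than the total weight, so that bits that are present round to positive numbers
and bits that are absent round to `0`.

The attention weights come from an equally sparse code (`positionKey`, `positionQuery`). The key of
`j` is a sign vector of length `L ≈ log₂ N` that encodes `j`, placed in the block of its colour, and
the query of `i` is `T` times the sum of the keys in its window. As colours do not repeat in a
window, the logit is `T * L` on the window, and at most `T * (L - 1)` outside of it up to the marker
term described next. Taking `T` of order `log N` makes the weight outside the window negligible.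

The output perceptron sees neither `i` nor `x_i`, so it must also learn which block belongs to `i`
itself. To this end each key carries a marker in its block and the query of `i` sets the marker of
its own colour, which raises the logit at `i` by one: inside the window, position `i` has `e` times
the weight of the others, and its block is the one with the largest marker after rounding.
`concentrated_query_mul_key` proves the bounds on the weights, the lemmas on `Concentrated` turn them
into bounds on the rounded outputs, and `decodes_iff` shows that the decoding is right.
-/

noncomputable section

namespace LocalMatch

/-! ### Integer formats and perceptrons -/

/-- The fixed-point format with `n + 1` bits and no fractional part: the integers in
`[-2 ^ n, 2 ^ n)`. -/
def intFormat (n : ℕ) : FixedPointFormat := ⟨n + 1, 0, Nat.zero_le _⟩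

lemma intFormat_lo (n : ℕ) : (intFormat n).lo = -2 ^ n := by
  simp only [FixedPointFormat.lo, intFormat, pow_succ]
  omega

lemma intFormat_hi (n : ℕ) : (intFormat n).hi = 2 ^ n - 1 := by
  simp only [FixedPointFormat.hi, intFormat, pow_succ]
  omega

lemma intCast_mem_values {n : ℕ} {k : ℤ} (hk : |k| < 2 ^ n) :
    (k : ℝ) ∈ (intFormat n).values := by
  rw [abs_lt] at hk
  refine ⟨k, ?_, ?_, ?_⟩
  · rw [intFormat_lo]; omega
  · rw [intFormat_hi]; omega
  · simp [intFormat]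

lemma zero_mem_values (n : ℕ) : (0 : ℝ) ∈ (intFormat n).values := by
  simpa using intCast_mem_values (n := n) (k := 0) (by simp)

lemma roundTo_intFormat {n : ℕ} {x : ℝ} (hlo : -2 ^ n ≤ round x) (hhi : round x < 2 ^ n) :
    (intFormat n).roundTo x = round x := by
  simp only [FixedPointFormat.roundTo, intFormat_lo, intFormat_hi]
  simp only [intFormat, pow_zero, mul_one, div_one]
  rw [min_eq_right (by omega), max_eq_right hlo]

lemma roundTo_intCast {n : ℕ} {k : ℤ} (hk : |k| < 2 ^ n) :
    (intFormat n).roundTo (k : ℝ) = k := by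
  rw [abs_lt] at hk
  have h : round (k : ℝ) = k := round_intCast k
  rw [roundTo_intFormat (by omega) (by omega), h]

lemma roundTo_roundTo (F : FixedPointFormat) (x : ℝ) :
    F.roundTo (F.roundTo x) = F.roundTo x := by
  have h2 : (2 : ℝ) ^ F.frac ≠ 0 := by positivity
  have hle : F.lo ≤ F.hi := by
    have : (1 : ℤ) ≤ 2 ^ F.bits := one_le_pow₀ (by norm_num)
    simp only [FixedPointFormat.lo, FixedPointFormat.hi]
    omega
  simp only [FixedPointFormat.roundTo]
  rw [div_mul_cancel₀ _ h2, round_intCast]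
  congr 2
  omega

/-- Any assignment of representable outputs to distinct rows that the input format reads exactly is
realised by a perceptron. -/
lemma exists_mlp {α : Type*} {N d d' : ℕ} {F₀ F : FixedPointFormat} (rows : α → Fin d → ℝ)
    (hinj : Function.Injective rows) (hrows : ∀ a k, F₀.roundTo (rows a k) = rows a k)
    (E : α → Fin d' → ℝ) (hE : ∀ a k, E a k ∈ F.values) (h0 : (0 : ℝ) ∈ F.values) :
    ∃ Φ ∈ mlps N d d' F₀ F, ∀ a : Fin N → α, ∀ i, Φ (fun i => rows (a i)) i = E (a i) := by
  classical
  let φ : (Fin d → ℝ) → Fin d' → ℝ :=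
    fun x => Function.extend rows E 0 (fun k => F₀.roundTo (x k))
  refine ⟨fun X i => φ (X i), ⟨φ, ?_, ?_, rfl⟩, ?_⟩
  · intro x
    simp only [φ, roundTo_roundTo]
  · intro x k
    simp only [φ]
    by_cases h : ∃ a, rows a = fun k => F₀.roundTo (x k)
    · obtain ⟨a, ha⟩ := h
      rw [← ha, hinj.extend_apply]
      exact hE a k
    · rw [Function.extend_apply' _ _ _ h]
      exact h0
  · intro a i
    simp only [φ, hrows, hinj.extend_apply]

/-! ### Transformers from queries, keys and values -/

/-- The attention average of the values `v` with softmax weights given by the logits `a`. -/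
def softmaxAverage {J : Type*} [Fintype J] (a v : J → ℝ) : ℝ :=
  ∑ j, Real.exp (a j) / (∑ j', Real.exp (a j')) * v j

/-- The 0-1 query matrix that matches the query group of coordinates with the key group. -/
def matchingMatrix {τ θ : Type*} {m : ℕ} (e : τ ⊕ τ ⊕ θ ≃ Fin m) : Matrix (Fin m) (Fin m) ℝ :=
  open Classical in
  fun x y => if ∃ t, e.symm x = Sum.inl t ∧ e.symm y = Sum.inr (Sum.inl t) then 1 else 0

lemma logit_matchingMatrix {τ θ : Type*} [Fintype τ] [Fintype θ] {m N : ℕ}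
    (e : τ ⊕ τ ⊕ θ ≃ Fin m) (q k : Fin N → τ → ℝ) (v : Fin N → θ → ℝ)
    (X : Matrix (Fin N) (Fin m) ℝ)
    (hX : ∀ i x, X i x = Sum.elim (q i) (Sum.elim (k i) (v i)) (e.symm x)) (i j : Fin N) :
    (X * matchingMatrix e * (1 : Matrix (Fin m) (Fin m) ℝ).transpose * X.transpose) i j =
      ∑ s, q i s * k j s := by
  classical
  rw [Matrix.transpose_one, Matrix.mul_one]
  simp only [Matrix.mul_apply, Matrix.transpose_apply]
  rw [← e.sum_comp]
  have h : ∀ y, ∑ x, X i x * matchingMatrix e x y =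
      ∑ x, X i (e x) * matchingMatrix e (e x) y := fun y => (e.sum_comp _).symm
  simp only [h]
  simp only [hX, matchingMatrix, Fintype.sum_sum_type, Equiv.symm_apply_apply, Sum.elim_inl,
    Sum.elim_inr]
  simp

lemma selfAttention_matchingMatrix {τ θ : Type*} [Fintype τ] [Fintype θ] {m N : ℕ}
    (e : τ ⊕ τ ⊕ θ ≃ Fin m) (q k : Fin N → τ → ℝ) (v : Fin N → θ → ℝ)
    (X : Matrix (Fin N) (Fin m) ℝ)
    (hX : ∀ i x, X i x = Sum.elim (q i) (Sum.elim (k i) (v i)) (e.symm x)) (B : ℝ) (i : Fin N)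
    (t : θ) :
    selfAttention (matchingMatrix e) 1 (B • (1 : Matrix (Fin m) (Fin m) ℝ)) X i
        (e (Sum.inr (Sum.inr t))) =
      B * softmaxAverage (fun j => ∑ s, q i s * k j s) (fun j => v j t) := by
  simp only [selfAttention, Matrix.mul_smul, Matrix.mul_one, Matrix.smul_apply, smul_eq_mul]
  rw [Matrix.mul_apply]
  simp only [rowSoftmax, logit_matchingMatrix e q k v X hX, softmaxAverage, hX,
    Equiv.symm_apply_apply, Sum.elim_inr]

/-- Queries, keys and values are stored in three disjoint groups of embedding coordinates. The query
matrix matches the query group with the key group, the key matrix is the identity, and the value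
matrix is `B` times the identity. -/
lemma exists_transformer {α τ θ : Type*} [Fintype τ] [Fintype θ] {N d n₀ n m : ℕ}
    (e : τ ⊕ τ ⊕ θ ≃ Fin m) (rows : α → Fin d → ℝ) (hinj : Function.Injective rows)
    (hrows : ∀ a k, (intFormat n₀).roundTo (rows a k) = rows a k)
    (q k : α → τ → ℝ) (v : α → θ → ℝ)
    (hq : ∀ a t, q a t ∈ (intFormat n).values) (hk : ∀ a t, k a t ∈ (intFormat n).values)
    (hv : ∀ a t, v a t ∈ (intFormat n).values) {B : ℤ} (hB : |B| < 2 ^ n) (hn : 1 ≤ n)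
    (P : (θ → ℝ) → Prop) [DecidablePred P] :
    ∃ f ∈ transformers N d m 1 1 1 (n₀ + 1) (n + 1),
      ∀ a : Fin N → α, ∀ i, f (fun i => rows (a i)) i 0 =
        if P (fun t => (intFormat n).roundTo
          (B * softmaxAverage (fun j => ∑ s, q (a i) s * k (a j) s) (fun j => v (a j) t)))
        then 1 else 0 := by
  classical
  have h0 := zero_mem_values n
  have h1 : (1 : ℝ) ∈ (intFormat n).values := by
    simpa using intCast_mem_values (n := n) (k := 1)
      (by simpa using one_lt_pow₀ (one_lt_two (α := ℤ)) (by omega))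
  obtain ⟨Φ, hΦ, hΦe⟩ := exists_mlp (N := N) (F := intFormat n) rows hinj hrows
    (fun a x => Sum.elim (q a) (Sum.elim (k a) (v a)) (e.symm x))
    (by
      intro a x
      rcases e.symm x with t | t | t
      · exact hq a t
      · exact hk a t
      · exact hv a t) h0
  let V : Matrix (Fin m) (Fin m) ℝ := (B : ℝ) • 1
  let ψ : (Fin m → ℝ) → Fin 1 → ℝ :=
    fun y _ => if P (fun t => (intFormat n).roundTo (y (e (Sum.inr (Sum.inr t))))) then 1 else 0
  have hunit : selfAttention (matchingMatrix e) 1 V ∈ attentionUnits N m m m (intFormat n) := by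
    refine ⟨matchingMatrix e, 1, V, ?_, ?_, ?_, rfl⟩
    · intro x y
      rw [matchingMatrix]
      split_ifs
      exacts [h1, h0]
    · intro x y
      rw [Matrix.one_apply]
      split_ifs
      exacts [h1, h0]
    · intro x y
      simp only [V, Matrix.smul_apply, Matrix.one_apply, smul_eq_mul, mul_ite, mul_one, mul_zero]
      split_ifs
      exacts [intCast_mem_values hB, h0]
  have hψ : (fun Y i => ψ (Y i)) ∈ mlps N m 1 (intFormat n) (intFormat n) := by
    refine ⟨ψ, ?_, ?_, rfl⟩
    · intro y
      simp only [ψ, roundTo_roundTo]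
    · intro y x
      simp only [ψ]
      split_ifs
      exacts [h1, h0]
  refine ⟨_, ⟨intFormat n₀, intFormat n, rfl, rfl, _, ⟨Φ, hΦ, _, ⟨fun _ => _, fun _ => hunit, rfl⟩,
    rfl⟩, _, hψ, rfl⟩, ?_⟩
  intro a i
  change (if P (fun t => (intFormat n).roundTo ((∑ _h : Fin 1, selfAttention (matchingMatrix e) 1 V
    (Φ fun i => rows (a i))) i (e (Sum.inr (Sum.inr t))))) then (1 : ℝ) else 0) = _
  simp only [Fin.sum_const, one_smul, V,
    selfAttention_matchingMatrix e (fun i => q (a i)) (fun i => k (a i)) (fun i => v (a i))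
      (Φ fun i => rows (a i)) (fun i x => by rw [hΦe])]

/-! ### Attention concentrated on a neighbourhood -/

lemma softmaxAverage_eq {J : Type*} [Fintype J] (a v : J → ℝ) (top : ℝ) :
    softmaxAverage a v =
      (∑ j, Real.exp (a j - top) * v j) / ∑ j, Real.exp (a j - top) := by
  have h : Real.exp top ≠ 0 := (Real.exp_pos _).ne'
  simp only [softmaxAverage, Real.exp_sub, ← Finset.sum_div, div_mul_eq_mul_div]
  rw [div_div_div_cancel_right₀ h]

/-- Unnormalised attention weights that put weight `e` on `i`, weight `1` on every other member of
the neighbourhood `S` of `i`, and a total weight on the rest that stays below `1 / 2` when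
multiplied by the scale `B`. The scale exceeds the total weight. -/
structure Concentrated {J : Type*} [Fintype J] (w : J → ℝ) (i : J) (S : Finset J) (B : ℝ) :
    Prop where
  mem : i ∈ S
  self : w i = Real.exp 1
  eq_one : ∀ j ∈ S, j ≠ i → w j = 1
  nonneg : ∀ j, 0 ≤ w j
  small : ∃ η, (∀ j ∉ S, w j ≤ η) ∧ 2 * B * (Fintype.card J * η) ≤ 1
  card_le : (S.card : ℝ) + 3 ≤ B

namespace Concentrated

variable {J : Type*} [Fintype J] {w : J → ℝ} {i : J} {S : Finset J} {B : ℝ}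

lemma four_le (h : Concentrated w i S B) : 4 ≤ B := by
  have : (1 : ℝ) ≤ S.card := by exact_mod_cast Finset.card_pos.2 ⟨i, h.mem⟩
  linarith [h.card_le]

lemma one_le (h : Concentrated w i S B) {j : J} (hj : j ∈ S) : 1 ≤ w j := by
  by_cases hji : j = i
  · rw [hji, h.self]
    linarith [Real.exp_one_gt_d9]
  · rw [h.eq_one j hj hji]

lemma sum_le (h : Concentrated w i S B) {v : J → ℝ} (h0 : ∀ j, 0 ≤ v j) (h1 : ∀ j, v j ≤ 1) :
    ∑ j, w j * v j ≤ ∑ j ∈ S, w j * v j + 1 / (2 * B) := by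
  classical
  obtain ⟨η, hη, hsmall⟩ := h.small
  have hB := h.four_le
  rw [← Finset.sum_add_sum_compl S]
  gcongr
  rcases (Sᶜ).eq_empty_or_nonempty with he | ⟨j₀, hj₀⟩
  · rw [he, Finset.sum_empty]
    positivity
  have hη0 : 0 ≤ η := (h.nonneg j₀).trans (hη j₀ (Finset.mem_compl.1 hj₀))
  calc ∑ j ∈ Sᶜ, w j * v j ≤ ∑ _j ∈ Sᶜ, η := by
        refine Finset.sum_le_sum fun j hj => ?_
        have := hη j (Finset.mem_compl.1 hj)
        nlinarith [h.nonneg j, h0 j, h1 j]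
    _ = (Sᶜ).card * η := by rw [Finset.sum_const, nsmul_eq_mul]
    _ ≤ Fintype.card J * η := by
        gcongr
        exact Finset.card_le_univ _
    _ ≤ 1 / (2 * B) := by
        rw [le_div_iff₀ (by positivity)]
        linarith

lemma le_sum (h : Concentrated w i S B) {v : J → ℝ} (h0 : ∀ j, 0 ≤ v j) (j : J) :
    w j * v j ≤ ∑ j, w j * v j :=
  Finset.single_le_sum (f := fun j => w j * v j) (fun j _ => mul_nonneg (h.nonneg j) (h0 j))
    (Finset.mem_univ j)

lemma one_lt_total (h : Concentrated w i S B) : 1 < ∑ j, w j := by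
  have := h.le_sum (v := fun _ => 1) (fun _ => zero_le_one) i
  simp only [mul_one, h.self] at this
  linarith [Real.exp_one_gt_d9]

lemma total_le (h : Concentrated w i S B) : ∑ j, w j ≤ B := by
  classical
  have h1 := h.sum_le (v := fun _ => 1) (fun _ => zero_le_one) (fun _ => le_rfl)
  simp only [mul_one] at h1
  have h2 : ∑ j ∈ S.erase i, w j = (S.card : ℝ) - 1 := by
    rw [Finset.sum_congr rfl (g := fun _ => (1 : ℝ))
      fun j hj => h.eq_one j (Finset.mem_of_mem_erase hj) (Finset.ne_of_mem_erase hj)]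
    rw [Finset.sum_const, Finset.card_erase_of_mem h.mem, nsmul_eq_mul, mul_one,
      Nat.cast_sub (Finset.card_pos.2 ⟨i, h.mem⟩), Nat.cast_one]
  have h3 := Finset.add_sum_erase S w h.mem
  have h4 : 1 / (2 * B) ≤ 1 / 8 := by
    have := h.four_le
    gcongr
    linarith
  linarith [h.card_le, h.self, Real.exp_one_lt_d9]

lemma average_nonneg (h : Concentrated w i S B) {v : J → ℝ} (h0 : ∀ j, 0 ≤ v j) :
    0 ≤ B * ((∑ j, w j * v j) / ∑ j, w j) := by
  have := h.four_le
  have := h.one_lt_total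
  have : 0 ≤ ∑ j, w j * v j := Finset.sum_nonneg fun j _ => mul_nonneg (h.nonneg j) (h0 j)
  positivity

lemma average_le (h : Concentrated w i S B) {v : J → ℝ} (h1 : ∀ j, v j ≤ 1) :
    B * ((∑ j, w j * v j) / ∑ j, w j) ≤ B := by
  have hB := h.four_le
  have hZ := h.one_lt_total
  have : (∑ j, w j * v j) / ∑ j, w j ≤ 1 := by
    rw [div_le_one (by linarith)]
    exact Finset.sum_le_sum fun j _ => mul_le_of_le_one_right (h.nonneg j) (h1 j)
  nlinarith

lemma sum_le_average (h : Concentrated w i S B) {v : J → ℝ} (h0 : ∀ j, 0 ≤ v j) :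
    ∑ j, w j * v j ≤ B * ((∑ j, w j * v j) / ∑ j, w j) := by
  have hZ := h.one_lt_total
  have : 0 ≤ ∑ j, w j * v j := Finset.sum_nonneg fun j _ => mul_nonneg (h.nonneg j) (h0 j)
  rw [mul_div_assoc', le_div_iff₀ (by linarith)]
  nlinarith [h.total_le]

lemma one_le_average (h : Concentrated w i S B) {v : J → ℝ} (h0 : ∀ j, 0 ≤ v j) {j : J}
    (hj : j ∈ S) (hv : v j = 1) : 1 ≤ B * ((∑ j, w j * v j) / ∑ j, w j) := by
  have := h.le_sum h0 j
  rw [hv, mul_one] at this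
  linarith [h.sum_le_average h0, h.one_le hj]

lemma average_lt_half (h : Concentrated w i S B) {v : J → ℝ} (h0 : ∀ j, 0 ≤ v j)
    (h1 : ∀ j, v j ≤ 1) (hv : ∀ j ∈ S, v j = 0) :
    B * ((∑ j, w j * v j) / ∑ j, w j) < 1 / 2 := by
  have hB := h.four_le
  have hZ := h.one_lt_total
  have hs := h.sum_le h0 h1
  have hS : ∑ j ∈ S, w j * v j = 0 := Finset.sum_eq_zero fun j hj => by rw [hv j hj, mul_zero]
  rw [hS, zero_add, le_div_iff₀ (by positivity)] at hs
  rw [mul_div_assoc', div_lt_iff₀ (by linarith)]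
  linarith

/-- Values seen only at a single `j ≠ i` of the neighbourhood average to at least one unit less,
after scaling, than values that are `1` at `i`: the gap `e - 1` between the weights survives. -/
lemma average_add_one_le (h : Concentrated w i S B) {v v' : J → ℝ} (h0 : ∀ j, 0 ≤ v j)
    (hi : v i = 1) (h0' : ∀ j, 0 ≤ v' j) (h1' : ∀ j, v' j ≤ 1) (hi' : v' i = 0)
    (huniq : ∀ j ∈ S, ∀ j' ∈ S, v' j ≠ 0 → v' j' ≠ 0 → j = j') :
    B * ((∑ j, w j * v' j) / ∑ j, w j) + 1 ≤ B * ((∑ j, w j * v j) / ∑ j, w j) := by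
  have hB := h.four_le
  have hZ := h.one_lt_total
  have hS : ∑ j ∈ S, w j * v' j ≤ 1 := by
    by_cases hex : ∃ j ∈ S, v' j ≠ 0
    · obtain ⟨j, hj, hvj⟩ := hex
      rw [Finset.sum_eq_single_of_mem j hj]
      · rw [h.eq_one j hj (fun hji => hvj (hji ▸ hi')), one_mul]
        exact h1' j
      · intro j' hj' hne
        rw [mul_eq_zero]
        right
        by_contra hv'
        exact hne (huniq j' hj' j hj hv' hvj)
    · push Not at hex
      rw [Finset.sum_eq_zero fun j hj => by rw [hex j hj, mul_zero]]
      exact zero_le_one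
  have h2 := h.sum_le h0' h1'
  have h3 := h.le_sum h0 i
  rw [hi, mul_one, h.self] at h3
  have h4 : 1 / (2 * B) ≤ 1 / 8 := by
    gcongr
    linarith
  have h5 : ∑ j, w j * v' j + 1 ≤ ∑ j, w j * v j := by linarith [Real.exp_one_gt_d9]
  rw [mul_div_assoc', mul_div_assoc', div_add_one (by linarith)]
  gcongr
  nlinarith [h.total_le]

end Concentrated

/-! ### Queries, keys and values for coloured neighbourhoods -/

section Coloured

variable {A R : Type*} [DecidableEq R] {N L b : ℕ}

/-- The sign `1` or `-1` that stands for a bit. -/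
def bitSign (x : Bool) : ℤ := if x then 1 else -1

lemma bitSign_mul_self (x : Bool) : bitSign x * bitSign x = 1 := by
  cases x <;> rfl

lemma bitSign_mul_le (x y : Bool) : bitSign x * bitSign y ≤ 1 := by
  cases x <;> cases y <;> decide

lemma sum_bitSign_le {x y : Fin L → Bool} (h : x ≠ y) :
    ∑ l, bitSign (x l) * bitSign (y l) ≤ (L : ℤ) - 1 := by
  obtain ⟨l, hl⟩ := Function.ne_iff.1 h
  have h1 : bitSign (x l) * bitSign (y l) < 1 := by
    revert hl
    cases x l <;> cases y l <;> decide
  have h2 : ∑ l, bitSign (x l) * bitSign (y l) < ∑ _l : Fin L, (1 : ℤ) :=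
    Finset.sum_lt_sum (fun l _ => bitSign_mul_le _ _) ⟨l, Finset.mem_univ l, h1⟩
  rw [Finset.sum_const, Finset.card_univ, Fintype.card_fin, nsmul_eq_mul, mul_one] at h2
  omega

/-- The key of position `j`: in the block of its colour `r j`, the signs of its binary code `u j`
and a marker `1`; zero in all other blocks. -/
def positionKey (u : Fin N → Fin L → Bool) (r : Fin N → R) (j : Fin N) :
    R × Option (Fin L) → ℤ :=
  fun s => if r j = s.1 then s.2.elim 1 (fun l => bitSign (u j l)) else 0

/-- The query of position `i`: the sum of the keys in its neighbourhood, scaled by `T`, except that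
the marker is set only in the block of the colour of `i` itself, and not scaled. -/
def positionQuery (T : ℕ) (u : Fin N → Fin L → Bool) (r : Fin N → R) (S : Fin N → Finset (Fin N))
    (i : Fin N) : R × Option (Fin L) → ℤ :=
  fun s => s.2.elim (if r i = s.1 then 1 else 0)
    (fun l => T * ∑ j ∈ S i with r j = s.1, bitSign (u j l))

/-- The value of a position of colour `ρ'` that carries a letter with binary code `x`: in the block
of its colour, the bits of the code and a marker `1`; zero in all other blocks. -/
def letterValue (ρ' : R) (x : Fin b → Bool) : R × Option (Fin b) → ℤ :=
  fun s => if ρ' = s.1 ∧ s.2.elim true x then 1 else 0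

lemma letterValue_nonneg (ρ' : R) (x : Fin b → Bool) (s : R × Option (Fin b)) :
    0 ≤ letterValue ρ' x s := by
  rw [letterValue]
  split_ifs <;> decide

lemma letterValue_le_one (ρ' : R) (x : Fin b → Bool) (s : R × Option (Fin b)) :
    letterValue ρ' x s ≤ 1 := by
  rw [letterValue]
  split_ifs <;> decide

lemma abs_positionKey_le (u : Fin N → Fin L → Bool) (r : Fin N → R) (j : Fin N)
    (s : R × Option (Fin L)) : |positionKey u r j s| ≤ 1 := by
  rcases s with ⟨ρ, _ | l⟩
  · simp only [positionKey, Option.elim]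
    split_ifs <;> decide
  · simp only [positionKey, Option.elim, bitSign]
    split_ifs <;> decide

/-- A colour occurs at most once in a neighbourhood on which the colouring is injective. -/
lemma filter_colour_eq {r : Fin N → R} {S : Finset (Fin N)} (hr : Set.InjOn r S) {j : Fin N}
    (hj : j ∈ S) : S.filter (fun j' => r j' = r j) = {j} := by
  ext j'
  simp only [Finset.mem_filter, Finset.mem_singleton]
  constructor
  · rintro ⟨h1, h2⟩
    exact hr h1 hj h2
  · rintro rfl
    exact ⟨hj, rfl⟩

lemma filter_colour_cases {r : Fin N → R} {S : Finset (Fin N)} (hr : Set.InjOn r S) (ρ : R) :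
    S.filter (fun j => r j = ρ) = ∅ ∨ ∃ j ∈ S, S.filter (fun j => r j = ρ) = {j} := by
  rcases (S.filter fun j => r j = ρ).eq_empty_or_nonempty with h | ⟨j, hj⟩
  · exact Or.inl h
  · obtain ⟨hjS, rfl⟩ := Finset.mem_filter.1 hj
    exact Or.inr ⟨j, hjS, filter_colour_eq hr hjS⟩

lemma abs_positionQuery_le {T : ℕ} (hT : 1 ≤ T) (u : Fin N → Fin L → Bool) {r : Fin N → R}
    {S : Fin N → Finset (Fin N)} {i : Fin N} (hr : Set.InjOn r (S i)) (s : R × Option (Fin L)) :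
    |positionQuery T u r S i s| ≤ T := by
  rcases s with ⟨ρ, _ | l⟩
  · simp only [positionQuery, Option.elim]
    split_ifs <;> simp [hT]
  · simp only [positionQuery, Option.elim]
    rcases filter_colour_cases hr ρ with h | ⟨j, -, h⟩
    · simp [h]
    · rw [h, Finset.sum_singleton, bitSign]
      split_ifs <;> simp

lemma query_mul_key [Fintype R] (T : ℕ) (u : Fin N → Fin L → Bool) (r : Fin N → R)
    (S : Fin N → Finset (Fin N)) (i j : Fin N) :
    ∑ s, positionQuery T u r S i s * positionKey u r j s =
      T * ∑ j' ∈ S i with r j' = r j, ∑ l, bitSign (u j' l) * bitSign (u j l) +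
        if r i = r j then 1 else 0 := by
  rw [Fintype.sum_prod_type, Finset.sum_eq_single (r j)]
  · simp only [Fintype.sum_option, positionQuery, positionKey, Option.elim, if_true, mul_one]
    rw [add_comm, Finset.sum_comm, Finset.mul_sum]
    simp only [Finset.sum_mul, mul_assoc]
  · intro ρ _ hρ
    refine Finset.sum_eq_zero fun o _ => ?_
    rw [positionKey, if_neg (Ne.symm hρ), mul_zero]
  · simp

/-- The softmax weights, normalised so that the neighbours of `i` other than `i` have weight `1`,
are concentrated on the neighbourhood of `i`: distinct codes have inner product at most `L - 1`, so
each position outside is damped by a factor of order `exp (-T)`. -/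
lemma concentrated_query_mul_key [Fintype R] {T : ℕ} {B : ℝ} (hL : 1 ≤ L)
    {u : Fin N → Fin L → Bool} (hu : Function.Injective u) {r : Fin N → R}
    {S : Fin N → Finset (Fin N)} {i : Fin N} (hi : i ∈ S i) (hr : Set.InjOn r (S i))
    (hcard : ((S i).card : ℝ) + 3 ≤ B) (hT : 2 * B * (N * Real.exp (1 - T)) ≤ 1) :
    Concentrated (fun j => Real.exp
      (((∑ s, positionQuery T u r S i s * positionKey u r j s : ℤ) : ℝ) - T * L)) i (S i) B := by
  have hin : ∀ j ∈ S i, ∑ s, positionQuery T u r S i s * positionKey u r j s =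
      T * L + if r i = r j then 1 else 0 := by
    intro j hj
    rw [query_mul_key, filter_colour_eq hr hj, Finset.sum_singleton]
    simp [bitSign_mul_self]
  have hout : ∀ j ∉ S i, ∑ s, positionQuery T u r S i s * positionKey u r j s ≤
      T * ((L : ℤ) - 1) + 1 := by
    intro j hj
    rw [query_mul_key]
    refine add_le_add (mul_le_mul_of_nonneg_left ?_ (Int.natCast_nonneg T)) ?_
    · rcases filter_colour_cases hr (r j) with h | ⟨j', hj', h⟩
      · rw [h, Finset.sum_empty]
        omega
      · rw [h, Finset.sum_singleton]
        exact sum_bitSign_le fun huj => hj (hu huj ▸ hj')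
    · split_ifs <;> decide
  refine ⟨hi, ?_, ?_, fun j => (Real.exp_pos _).le, ⟨Real.exp (1 - T), ?_, ?_⟩, hcard⟩
  · simp only [hin i hi, if_true]
    push_cast
    rw [add_sub_cancel_left]
  · intro j hj hji
    have hne : r i ≠ r j := fun h => hji (hr hj hi h.symm)
    simp only [hin j hj, if_neg hne]
    push_cast
    rw [add_zero, sub_self, Real.exp_zero]
  · intro j hj
    rw [Real.exp_le_exp]
    have h : ((∑ s, positionQuery T u r S i s * positionKey u r j s : ℤ) : ℝ) ≤
        ((T * ((L : ℤ) - 1) + 1 : ℤ) : ℝ) := Int.cast_le.2 (hout j hj)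
    push_cast at h ⊢
    linarith
  · rwa [Fintype.card_fin]

/-! ### Functions of neighbourhoods -/

/-- The output perceptron's test. It finds the colour with the largest marker, which is that of the
position itself, reads the letter there, and applies `G` to it and to the set of the letters read
off from all blocks with a positive marker. -/
def decodes (code : A → Fin b → Bool) (G : A → Set A → Prop) (y : R × Option (Fin b) → ℝ) :
    Prop :=
  ∃ ρ₀ a₀, (∀ ρ, y (ρ, none) ≤ y (ρ₀, none)) ∧
    (∀ l, 0 < y (ρ₀, some l) ↔ code a₀ l = true) ∧
    G a₀ {a | ∃ ρ, 0 < y (ρ, none) ∧ ∀ l, 0 < y (ρ, some l) ↔ code a l = true}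

lemma decodes_iff {code : A → Fin b → Bool} (hcode : Function.Injective code)
    (G : A → Set A → Prop) {y : R × Option (Fin b) → ℝ} {r : Fin N → R} {S : Finset (Fin N)}
    {i : Fin N} (hi : i ∈ S) (x : Fin N → A)
    (hmark : ∀ ρ, 0 < y (ρ, none) ↔ ∃ j ∈ S, r j = ρ)
    (hmax : ∀ ρ, ρ ≠ r i → y (ρ, none) < y (r i, none))
    (hbit : ∀ j ∈ S, ∀ l, 0 < y (r j, some l) ↔ code (x j) l = true) :
    decodes code G y ↔ G (x i) (x '' S) := by
  have hread : ∀ j ∈ S, ∀ a, (∀ l, 0 < y (r j, some l) ↔ code a l = true) ↔ a = x j := by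
    intro j hj a
    refine ⟨fun h => hcode (funext fun l => ?_), fun h => h ▸ hbit j hj⟩
    rw [Bool.eq_iff_iff, ← h l, hbit j hj l]
  have hset : {a | ∃ ρ, 0 < y (ρ, none) ∧ ∀ l, 0 < y (ρ, some l) ↔ code a l = true} = x '' S := by
    ext a
    constructor
    · rintro ⟨ρ, hρ, ha⟩
      obtain ⟨j, hj, rfl⟩ := (hmark ρ).1 hρ
      exact ⟨j, hj, ((hread j hj a).1 ha).symm⟩
    · rintro ⟨j, hj, rfl⟩
      exact ⟨r j, (hmark _).2 ⟨j, hj, rfl⟩, hbit j hj⟩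
  rw [decodes, hset]
  constructor
  · rintro ⟨ρ₀, a₀, h1, h2, h3⟩
    have hρ : ρ₀ = r i := by
      by_contra h
      exact (hmax ρ₀ h).not_ge (h1 (r i))
    subst hρ
    rwa [(hread i hi a₀).1 h2] at h3
  · intro h
    refine ⟨r i, x i, fun ρ => ?_, hbit i hi, h⟩
    by_cases hρ : ρ = r i
    · rw [hρ]
    · exact (hmax ρ hρ).le

lemma round_pos_of_one_le {x : ℝ} (h : 1 ≤ x) : 0 < round x := by
  rw [round_eq, Int.floor_pos]
  linarith

lemma round_nonpos_of_lt_half {x : ℝ} (h : x < 1 / 2) : round x ≤ 0 := by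
  rw [round_eq, ← Int.lt_add_one_iff, Int.floor_lt]
  push_cast
  linarith

lemma round_lt_round_of_add_one_le {x y : ℝ} (h : x + 1 ≤ y) : round x < round y := by
  have h1 : round (x + 1) ≤ round y := by
    rw [round_eq, round_eq]
    exact Int.floor_le_floor (by linarith)
  rw [round_add_one] at h1
  omega

/-- Every function of the letter at a position and the set of letters in its neighbourhood is
computed by a transformer with one block of embedding coordinates per colour, as soon as the
positions of each neighbourhood have distinct colours. -/
theorem exists_transformer_of_colouring [Fintype R] {d n₀ n m T B : ℕ}
    (e : (R × Option (Fin L)) ⊕ (R × Option (Fin L)) ⊕ (R × Option (Fin b)) ≃ Fin m)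
    (rows : Fin N × A → Fin d → ℝ) (hinj : Function.Injective rows)
    (hrows : ∀ a k, (intFormat n₀).roundTo (rows a k) = rows a k)
    {code : A → Fin b → Bool} (hcode : Function.Injective code)
    {u : Fin N → Fin L → Bool} (hu : Function.Injective u) (hL : 1 ≤ L) {r : Fin N → R}
    {S : Fin N → Finset (Fin N)} (hS : ∀ i, i ∈ S i) (hr : ∀ i, Set.InjOn r (S i))
    (hcard : ∀ i, (S i).card + 3 ≤ B) (hn : 1 ≤ n) (hT1 : 1 ≤ T) (hTn : T < 2 ^ n)
    (hBn : B < 2 ^ n) (hT : 2 * B * (N * Real.exp (1 - T)) ≤ 1) (G : A → Set A → Prop)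
    [∀ a s, Decidable (G a s)] :
    ∃ f ∈ transformers N d m 1 1 1 (n₀ + 1) (n + 1), ∀ x : Fin N → A, ∀ i,
      f (fun i => rows (i, x i)) i 0 = if G (x i) (x '' S i) then 1 else 0 := by
  classical
  have hTn' : (T : ℤ) < 2 ^ n := by exact_mod_cast hTn
  have hBn' : (B : ℤ) < 2 ^ n := by exact_mod_cast hBn
  have h1n : (1 : ℤ) < 2 ^ n := one_lt_pow₀ one_lt_two (by omega)
  obtain ⟨f, hf, hfe⟩ := exists_transformer (N := N) (n := n) e rows hinj hrows
    (fun a s => (positionQuery T u r S a.1 s : ℝ)) (fun a s => (positionKey u r a.1 s : ℝ))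
    (fun a s => (letterValue (r a.1) (code a.2) s : ℝ))
    (fun a s => intCast_mem_values ((abs_positionQuery_le hT1 u (hr a.1) s).trans_lt hTn'))
    (fun a s => intCast_mem_values ((abs_positionKey_le u r a.1 s).trans_lt h1n))
    (fun a s => intCast_mem_values (by
      have h0 := letterValue_nonneg (r a.1) (code a.2) s
      have h1 := letterValue_le_one (r a.1) (code a.2) s
      rw [abs_lt]
      omega))
    (B := B) (by simpa using hBn') hn (decodes code G)
  refine ⟨f, hf, fun x i => ?_⟩
  rw [hfe fun i => (i, x i)]
  have hC := concentrated_query_mul_key (T := T) (B := B) hL hu (hS i) (hr i)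
    (by exact_mod_cast hcard i) hT
  set w : Fin N → ℝ := fun j => Real.exp
    (((∑ s, positionQuery T u r S i s * positionKey u r j s : ℤ) : ℝ) - T * L)
  let v : R × Option (Fin b) → Fin N → ℝ := fun t j => (letterValue (r j) (code (x j)) t : ℝ)
  have hv0 : ∀ t j, 0 ≤ v t j := fun t j => Int.cast_nonneg (letterValue_nonneg _ _ t)
  have hv1 : ∀ t j, v t j ≤ 1 := fun t j =>
    (Int.cast_le.2 (letterValue_le_one _ _ t)).trans_eq Int.cast_one
  let Y : R × Option (Fin b) → ℝ := fun t => B * ((∑ j, w j * v t j) / ∑ j, w j)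
  have hY : ∀ t, (intFormat n).roundTo (((B : ℤ) : ℝ) * softmaxAverage
      (fun j => ∑ s, (positionQuery T u r S i s : ℝ) * (positionKey u r j s : ℝ))
      (fun j => (letterValue (r j) (code (x j)) t : ℝ))) = (round (Y t) : ℝ) := by
    intro t
    rw [softmaxAverage_eq _ _ (T * L : ℝ)]
    have h : ((B : ℤ) : ℝ) * ((∑ j, Real.exp ((∑ s, (positionQuery T u r S i s : ℝ) *
        (positionKey u r j s : ℝ)) - T * L) * (letterValue (r j) (code (x j)) t : ℝ)) /
        ∑ j, Real.exp ((∑ s, (positionQuery T u r S i s : ℝ) *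
        (positionKey u r j s : ℝ)) - T * L)) = Y t := by
      simp only [Y, w, v]
      push_cast
      rfl
    rw [h]
    have h0 : 0 ≤ round (Y t) := by
      rw [round_eq, Int.floor_nonneg]
      linarith [hC.average_nonneg (hv0 t)]
    have h1 : round (Y t) ≤ B := by
      rw [round_eq, ← Int.lt_add_one_iff, Int.floor_lt]
      push_cast
      linarith [hC.average_le (hv1 t)]
    exact roundTo_intFormat (by omega) (by omega)
  simp only [hY]
  have hpos : ∀ t, ∀ j ∈ S i, v t j = 1 → (0 : ℝ) < round (Y t) := fun t j hj h => by
    exact_mod_cast round_pos_of_one_le (hC.one_le_average (hv0 t) hj h)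
  have hnonpos : ∀ t, (∀ j ∈ S i, v t j = 0) → ¬ (0 : ℝ) < round (Y t) := fun t h => by
    rw [not_lt]
    exact_mod_cast round_nonpos_of_lt_half (hC.average_lt_half (hv0 t) (hv1 t) h)
  have hdec : decodes code G (fun t => (round (Y t) : ℝ)) ↔ G (x i) (x '' S i) := by
    refine decodes_iff (r := r) hcode G (hS i) x ?_ ?_ ?_
    · intro ρ
      constructor
      · intro h
        by_contra! hne
        refine hnonpos _ (fun j hj => ?_) h
        simp [v, letterValue, hne j hj]
      · rintro ⟨j, hj, rfl⟩
        exact hpos _ j hj (by simp [v, letterValue])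
    · intro ρ hρ
      have : round (Y (ρ, none)) < round (Y (r i, none)) := by
        refine round_lt_round_of_add_one_le (hC.average_add_one_le (hv0 _) ?_ (hv0 _) (hv1 _) ?_ ?_)
        · simp [v, letterValue]
        · simp [v, letterValue, Ne.symm hρ]
        · intro j hj j' hj' h h'
          simp only [v, letterValue, Option.elim, and_true, ne_eq, Int.cast_eq_zero,
            ite_eq_right_iff, one_ne_zero, imp_false, not_not] at h h'
          exact hr i hj hj' (h.trans h'.symm)
      exact_mod_cast this
    · intro j hj l
      constructor
      · intro h
        by_contra hne
        refine hnonpos _ (fun j' hj' => ?_) h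
        have : ¬ (r j' = r j ∧ code (x j') l = true) := fun hh =>
          hne (hr i hj' hj hh.1 ▸ hh.2)
        exact Int.cast_eq_zero.2 (if_neg this)
      · intro h
        exact hpos _ j hj (by simp [v, letterValue, h])
  exact if_congr hdec rfl rfl

end Coloured

/-! ### Windows and sizes -/

/-- The positions at distance at most `K` from `i`. -/
def window {N : ℕ} (K : ℕ) (i : Fin N) : Finset (Fin N) :=
  Finset.univ.filter fun j : Fin N => |(i : ℤ) - (j : ℤ)| ≤ K

lemma mem_window {N K : ℕ} {i j : Fin N} : j ∈ window K i ↔ |(i : ℤ) - (j : ℤ)| ≤ K := by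
  simp [window]

/-- The residue of a position modulo the window length `2 * K + 1`, which serves as its colour. -/
def residue {N : ℕ} (K : ℕ) (j : Fin N) : Fin (2 * K + 1) :=
  ⟨j % (2 * K + 1), Nat.mod_lt _ (by omega)⟩

lemma residue_injOn_window {N K : ℕ} (i : Fin N) :
    Set.InjOn (residue K) (window K i : Set (Fin N)) := by
  intro j hj j' hj' h
  rw [Finset.mem_coe, mem_window, abs_le] at hj hj'
  simp only [residue, Fin.mk.injEq] at h
  have hdvd : ((2 * K + 1 : ℕ) : ℤ) ∣ (j' : ℤ) - j := (Nat.modEq_iff_dvd).1 h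
  have h0 := Int.eq_zero_of_abs_lt_dvd hdvd (by rw [abs_lt]; push_cast; omega)
  exact Fin.ext (by omega)

lemma exists_injective_code (α : Type*) [Fintype α] {n : ℕ} (h : Fintype.card α ≤ 2 ^ n) :
    ∃ f : α → Fin n → Bool, Function.Injective f := by
  obtain ⟨f⟩ := Function.Embedding.nonempty_of_card_le (α := α) (β := Fin n → Bool) (by simpa)
  exact ⟨f, f.injective⟩

lemma mul_exp_le_one {N K L : ℕ} (hN : 2 ≤ N) (hK : K ≤ N) (hL : N ≤ 2 ^ L) :
    2 * ((2 * K + 4 : ℕ) : ℝ) * (N * Real.exp (1 - (2 * L + 4 : ℕ))) ≤ 1 := by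
  have h1 : ((2 : ℝ) ^ (2 * L + 3)) ≤ Real.exp ((2 * L + 3 : ℕ) : ℝ) := by
    rw [← Real.exp_one_pow]
    gcongr
    linarith [Real.exp_one_gt_d9]
  have h2 : (1 : ℝ) - (2 * L + 4 : ℕ) = -((2 * L + 3 : ℕ) : ℝ) := by
    push_cast
    ring
  have hNR : (N : ℝ) ≤ 2 ^ L := by exact_mod_cast hL
  have hKR : (K : ℝ) ≤ N := by exact_mod_cast hK
  have hN2 : (2 : ℝ) ≤ N := by exact_mod_cast hN
  have h3 : 2 * ((2 * K + 4 : ℕ) : ℝ) * N ≤ 2 ^ (2 * L + 3) := by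
    have h4 : (2 : ℝ) ^ (2 * L + 3) = 8 * ((2 ^ L) * (2 ^ L)) := by ring
    rw [h4]
    push_cast
    calc 2 * (2 * (K : ℝ) + 4) * N ≤ 8 * (N * N) := by nlinarith
      _ ≤ _ := by gcongr
  rw [h2, Real.exp_neg, ← mul_assoc, ← div_eq_mul_inv, div_le_one (Real.exp_pos _)]
  exact h3.trans h1

lemma clog_le_two_mul_logb {N : ℕ} (hN : 2 ≤ N) :
    (Nat.clog 2 N : ℝ) ≤ 2 * Real.logb 2 N := by
  have h1 : 1 ≤ Real.logb 2 N := by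
    rw [Real.le_logb_iff_rpow_le one_lt_two (by positivity), Real.rpow_one]
    exact_mod_cast hN
  have h2 : Nat.clog 2 N ≤ Nat.log 2 N + 1 :=
    (Nat.clog_le_iff_le_pow one_lt_two).2 (Nat.lt_pow_succ_log_self one_lt_two N).le
  have h3 : (Nat.log 2 N : ℝ) ≤ Real.logb 2 N := by exact_mod_cast Real.natLog_le_logb N 2
  have h4 : (Nat.clog 2 N : ℝ) ≤ Nat.log 2 N + 1 := by exact_mod_cast h2
  linarith

lemma match3Local_eq {N d M K : ℕ} (X : Fin N → Fin d → ℕ) (x : Fin N → Fin d → Fin (M + 1))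
    (hx : ∀ i k, (x i k : ℕ) = X i k) (i : Fin N)
    [Decidable (∃ a ∈ x '' window K i, ∃ b ∈ x '' window K i,
      ∀ k, (x i k : ℕ) + a k + b k ≡ 0 [MOD M])] :
    match3Local M K X i =
      if ∃ a ∈ x '' window K i, ∃ b ∈ x '' window K i, ∀ k, (x i k : ℕ) + a k + b k ≡ 0 [MOD M]
      then 1 else 0 := by
  rw [match3Local]
  refine if_congr ?_ rfl rfl
  simp only [Set.exists_mem_image, Finset.mem_coe, mem_window, hx]
  constructor
  · rintro ⟨j₁, j₂, h, h₁, h₂⟩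
    exact ⟨j₁, h₁, j₂, h₂, h⟩
  · rintro ⟨j₁, h₁, j₂, h₂, h⟩
    exact ⟨j₁, j₂, h, h₁, h₂⟩

end LocalMatch

end

open LocalMatch in
theorem theorem4p4 (d c : ℕ) :
    ∃ C : ℝ, ∀ N M K : ℕ, 2 ≤ N → 1 ≤ M → M ≤ N ^ c → 1 ≤ K → K ≤ N →
      ∃ m p₀ p : ℕ,
        (m : ℝ) ≤ C * (K * Real.logb 2 N) ∧
        (p₀ : ℝ) ≤ C * Real.logb 2 N ∧
        (p : ℝ) ≤ C * (1 + Real.logb 2 (K * Real.logb 2 N)) ∧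
        ∃ f ∈ LocalMatch.transformers N (d + 1) m 1 1 1 p₀ p,
          ∀ X : Fin N → Fin d → ℕ, (∀ i k, 1 ≤ X i k ∧ X i k ≤ M) →
            ∀ i, f (LocalMatch.withPosition X) i 0 = LocalMatch.match3Local M K X i := by
  classical
  refine ⟨6 * (5 + (c + 1) * d) + (2 * (c + 1) + 2), fun N M K hN _ hM hK hKN => ?_⟩
  have hlog : 1 ≤ Real.logb 2 N := by
    rw [Real.le_logb_iff_rpow_le one_lt_two (by positivity), Real.rpow_one]
    exact_mod_cast hN
  have hL2 := clog_le_two_mul_logb hN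
  have hNL : N ≤ 2 ^ Nat.clog 2 N := Nat.le_pow_clog one_lt_two N
  have hL1 : 1 ≤ Nat.clog 2 N := Nat.clog_pos one_lt_two hN
  generalize Nat.clog 2 N = L at hL2 hNL hL1
  have hMN : M + 1 ≤ 2 ^ (L * (c + 1)) := by
    have h1 : 1 ≤ N ^ c := Nat.one_le_pow _ _ (by omega)
    calc M + 1 ≤ N ^ c * N := by nlinarith
      _ = N ^ (c + 1) := (pow_succ _ _).symm
      _ ≤ (2 ^ L) ^ (c + 1) := Nat.pow_le_pow_left hNL _
      _ = 2 ^ (L * (c + 1)) := (pow_mul _ _ _).symm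
  have hNL' : N ≤ 2 ^ (L * (c + 1)) :=
    hNL.trans (Nat.pow_le_pow_right two_pos (Nat.le_mul_of_pos_right _ (by omega)))
  obtain ⟨u, hu⟩ := exists_injective_code (Fin N) (n := L) (by simpa using hNL)
  obtain ⟨code, hcode⟩ := exists_injective_code (Fin d → Fin (M + 1)) (n := L * (c + 1) * d) (by
    rw [Fintype.card_fun, Fintype.card_fin, Fintype.card_fin, pow_mul]
    exact Nat.pow_le_pow_left hMN d)
  -- Rows carry numbers up to `max N M`, so `L * (c + 1) + 1` bits and a sign suffice to read them.
  let rows : Fin N × (Fin d → Fin (M + 1)) → Fin (d + 1) → ℝ :=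
    fun a => Fin.cons ((a.1 : ℝ) + 1) (fun k => ((a.2 k : ℕ) : ℝ))
  have hinj : Function.Injective rows := by
    rintro ⟨i, x⟩ ⟨i', x'⟩ h
    obtain ⟨h1, h2⟩ := Fin.cons_injective2 h
    refine Prod.ext (Fin.ext ?_) (funext fun k => Fin.ext ?_)
    · exact_mod_cast add_right_cancel h1
    · exact_mod_cast congrFun h2 k
  have hpow : (2 : ℤ) ^ (L * (c + 1) + 1) = 2 * 2 ^ (L * (c + 1)) := pow_succ' _ _
  have hrows : ∀ a k, (intFormat (L * (c + 1) + 1)).roundTo (rows a k) = rows a k := by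
    have key : ∀ k : ℕ, k ≤ 2 ^ (L * (c + 1)) →
        (intFormat (L * (c + 1) + 1)).roundTo (k : ℝ) = k := by
      intro k hk
      have h1 : (k : ℤ) ≤ 2 ^ (L * (c + 1)) := by exact_mod_cast hk
      have h2 : (0 : ℤ) < 2 ^ (L * (c + 1)) := by positivity
      have := roundTo_intCast (n := L * (c + 1) + 1) (k := k) (by rw [Nat.abs_cast]; omega)
      exact_mod_cast this
    intro a k
    refine Fin.cases ?_ (fun k => ?_) k
    · have := key (a.1 + 1) (by have := a.1.2; omega)
      push_cast at this
      exact this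
    · exact key (a.2 k) (by have := (a.2 k).2; omega)
  have hcard : ∀ i : Fin N, (window K i).card + 3 ≤ 2 * K + 4 := by
    intro i
    have := Finset.card_le_card_of_injOn (residue K) (t := Finset.univ)
      (fun _ _ => Finset.mem_univ _) (residue_injOn_window i)
    rw [Finset.card_univ, Fintype.card_fin] at this
    omega
  have hKL : K * L < 2 ^ (Nat.log 2 (K * L) + 1) := Nat.lt_pow_succ_log_self one_lt_two _
  have hn : (2 : ℕ) ^ (Nat.log 2 (K * L) + 4) = 8 * 2 ^ (Nat.log 2 (K * L) + 1) := by ring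
  have hKKL : K ≤ K * L := Nat.le_mul_of_pos_right _ hL1
  have hLKL : L ≤ K * L := Nat.le_mul_of_pos_left _ hK
  -- Queries reach `T = 2 * L + 4`, where `exp T` outweighs the `N ≤ 2 ^ L` positions outside the
  -- window even after scaling by `B = 2 * K + 4 ≤ 4 * N`; `8 * (K * L + 1)` bounds both
  -- `T` and `B`, which fixes the precision.
  obtain ⟨f, hf, hfe⟩ := exists_transformer_of_colouring (n := Nat.log 2 (K * L) + 4)
    (T := 2 * L + 4) (B := 2 * K + 4) (Fintype.equivFin _) rows hinj hrows hcode hu hL1 (r := residue K)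
    (S := window K) (fun i => by simp [mem_window]) residue_injOn_window hcard (by omega) (by omega) (by omega) (by omega)
    (mul_exp_le_one hN hKN hNL)
    (fun a s => ∃ a' ∈ s, ∃ b ∈ s, ∀ k, (a k : ℕ) + a' k + b k ≡ 0 [MOD M])
  refine ⟨_, _, _, ?_, ?_, ?_, f, hf, fun X hX i => ?_⟩
  · have hK1 : (1 : ℝ) ≤ K := by exact_mod_cast hK
    have hLR : (1 : ℝ) ≤ L := by exact_mod_cast hL1
    simp only [Fintype.card_sum, Fintype.card_prod, Fintype.card_option, Fintype.card_fin]
    push_cast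
    calc (2 * (K : ℝ) + 1) * (L + 1) + ((2 * K + 1) * (L + 1) +
          (2 * K + 1) * (L * (c + 1) * d + 1))
        = (2 * (K : ℝ) + 1) * (2 * L + L * (c + 1) * d + 3) := by ring
      _ ≤ (3 * K) * (2 * L + L * (c + 1) * d + 3 * L) := by
          gcongr <;> linarith
      _ = 3 * (5 + (c + 1) * d) * K * L := by ring
      _ ≤ 3 * (5 + (c + 1) * d) * K * (2 * Real.logb 2 N) := by gcongr
      _ = 6 * (5 + (c + 1) * d) * (K * Real.logb 2 N) := by ring
      _ ≤ _ := by
          refine mul_le_mul_of_nonneg_right ?_ (by positivity)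
          linarith [show (0 : ℝ) ≤ 2 * (c + 1 : ℝ) + 2 by positivity]
  · push_cast
    calc (L : ℝ) * (c + 1) + 1 + 1 ≤ (2 * Real.logb 2 N) * (c + 1) + 2 * Real.logb 2 N := by
          nlinarith [show (0 : ℝ) ≤ c by positivity]
      _ = (2 * (c + 1) + 2) * Real.logb 2 N := by ring
      _ ≤ _ := by
          refine mul_le_mul_of_nonneg_right ?_ (by linarith)
          linarith [show (0 : ℝ) ≤ 6 * (5 + (c + 1) * d : ℝ) by positivity]
  · have hK1 : (1 : ℝ) ≤ K := by exact_mod_cast hK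
    have hprod : (1 : ℝ) ≤ K * Real.logb 2 N := one_le_mul_of_one_le_of_one_le hK1 hlog
    have hnonneg : 0 ≤ Real.logb 2 (K * Real.logb 2 N) := Real.logb_nonneg one_lt_two hprod
    have h1 : (Nat.log 2 (K * L) : ℝ) ≤ Real.logb 2 ((K * L : ℕ) : ℝ) := by
      exact_mod_cast Real.natLog_le_logb (K * L) 2
    have h2 : Real.logb 2 ((K * L : ℕ) : ℝ) ≤ Real.logb 2 (2 * (K * Real.logb 2 N)) := by
      refine Real.logb_le_logb_of_le one_lt_two (by exact_mod_cast Nat.mul_pos hK hL1) ?_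
      push_cast
      nlinarith
    have h3 : Real.logb 2 (2 * (K * Real.logb 2 N)) = 1 + Real.logb 2 (K * Real.logb 2 N) := by
      rw [Real.logb_mul two_ne_zero (by positivity), Real.logb_self_eq_one one_lt_two]
    push_cast
    have h4 : (6 : ℝ) ≤ 6 * (5 + (c + 1) * d) + (2 * (c + 1) + 2) := by
      nlinarith [show (0 : ℝ) ≤ (c + 1) * d by positivity, show (0 : ℝ) ≤ c by positivity]
    calc (Nat.log 2 (K * L) : ℝ) + 4 + 1 ≤ 6 * (1 + Real.logb 2 (K * Real.logb 2 N)) := by linarith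
      _ ≤ _ := by gcongr
  · let x : Fin N → Fin d → Fin (M + 1) := fun i k => ⟨X i k, Nat.lt_succ_of_le (hX i k).2⟩
    have hrow : withPosition X = fun i => rows (i, x i) := rfl
    rw [hrow, hfe x i, match3Local_eq X x (fun _ _ => rfl) i]
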